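/- Let $T=\prod_{n\in\mathbb N}\{0,\dots,2^n-1\}$ with the product topology, let $\mathcal B$ be the algebra of clopen subsets of $T$, let $\mathcal B_n$ be the subalgebra of those sets that depend only on the coordinates $<n$, and let $\mathcal A_n$ be the set of atoms of $\mathcal B_n$. For $A\in\mathcal A_m$ let $\pi_A:T\to A$ replace the coordinates $<m$ of a point by those of the points of $A$. For $X\in\mathcal B$ let ${\rm int}_n(X)=\bigcup\{A\in\mathcal A_n: A\subseteq X\}$, and let $n(X)$ be the least $n$ with $X\in\mathcal B_n$. A submeasure on $\mathcal B$ is a monotone subadditive function $\nu:\mathcal B\to[0,+\infty]$ with $\nu(\emptyset)=0$. An admissible norm is a function $\|\cdot\|:[\mathbb N]^{<\omega}\to\mathbb N$ such that $\|\emptyset\|=0$; $\|\{n\}\|=1$ for all $n$; $\|A\|\le\|B\|$ if $A\subseteq B$; $\|A\cup B\|\le\|A\|+\|B\|$; $\lim_n\|A\cap\{0,\dots,n-1\}\|=\infty$ for every infinite $A\subseteq\mathbb N$; and $\|A\|\le\|B\|$ whenever $|A|=|B|$ and the increasing enumeration of $A$ is pointwise $\le$ that of $B$. A set $X\in\mathcal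 B$ is $(m,n,\nu)$-thin if for every $A\in\mathcal A_m$ there is $H\in\mathcal B_n$ with $H\subseteq A\setminus X$ and $\nu(\pi_A^{-1}(H))>1$. It is $(I,\nu)$-thin if it is $(m,n,\nu)$-thin for all $m<n$ in $I$. Given $N\in\mathbb Z$ and $M_N\in\mathbb N$, $\nu$ has the $N$-thinness property relative to $\|\cdot\|$ if $\nu(X)\le 2^{-N}$ for every $X\in\mathcal B$ which is $(I,\nu)$-thin for some finite $I\subseteq\mathbb N$ with $\|I\|=M_N$. The submeasure $\nu$ has the covering property if for every $m$ and every $E\in\mathcal B$ that does not depend on the coordinates $<m$ and satisfies $\nu(E)<2$ there are sets $C_r$, $m<r\le n(E)$, such that each $C_r\in\mathcal B_r$ does not depend on the coordinates $<m$; ${\rm int}_j(E)\subseteq\bigcup_{m<r\le j}C_r$ for every $j$ with $m<j\le n(E)$; and $\sum_{m<r\le n(E)}\nu(C_r)\le 4$. For a family $\mathscr S$ of finite subsets of $\mathbb N$, let $\rho(\mathscr S)$ be the least ordinal $\alpha$ such that Player I has a winning strategy in the following game. Player I moves first and plays a strictly decreasing sequence of ordinals $\le\alpha$, Player II plays a strictly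 increasing sequence $n_0<n_1<\cdots$ of natural numbers with $\{n_0,\dots,n_k\}\in\mathscr S$ for all $k$, the players alternate, and the first player who cannot play loses. For an ordinal $\xi$ and $\epsilon>0$, let $\mathcal E(\xi)$ be the game in which Player I moves first and plays a strictly decreasing sequence of ordinals $\le\xi$, Player II plays pairwise disjoint sets $E_n\in\mathcal B$ with $\nu(E_n)\ge 2^{-N}+\epsilon$, the players alternate, and the first player who cannot play loses. For $c>0$ let $\mathcal D_c(\nu)$ be the set of all finite pairwise disjoint $F\subseteq\mathcal B$ with $\nu(a)\ge c$ for all $a\in F$. If $(\mathcal D_c(\nu),\supsetneq)$ is well-founded, the $c$-exhaustivity rank of $\nu$ is ${\rm rk}_c(\nu,\emptyset)$, where ${\rm rk}_c(\nu,F)=\sup\{{\rm rk}_c(\nu,G)+1: G\in\mathcal D_c(\nu),\ G\supsetneq F\}$. **Lemma.** Let $\nu$ be a submeasure on $\mathcal B$ with the covering property and with $\nu(T)\ge 8$. Let $\|\cdot\|$ be an admissible norm, let $N\in\mathbb Z$ and $M_N\in\mathbb N$, and suppose that $\nu$ has the $N$-thinness property relative to $\|\cdot\|$. Let $\beta=\rho(\{F\in[\mathbb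 N]^{<\omega}:\|F\|<M_N\})$ and let $\epsilon>0$. Then Player I has a winning strategy in the game $\mathcal E(\omega^{\omega\cdot(\beta+1)})$. Hence $(\mathcal D_{2^{-N}+\epsilon}(\nu),\supsetneq)$ is well-founded, and the $(2^{-N}+\epsilon)$-exhaustivity rank of $\nu$ is at most $\omega^{\omega\cdot(\beta+1)}$. -/

import Mathlib

open scoped ENNReal Ordinal

namespace ExhaustivityRank

/-! ### Games in which Player I counts down ordinals -/

section Games

variable {α : Type*}

/-- `legal h a` says that Player II may play `a` when his previous moves, in chronological order,
are the members of the list `h`. A finite list of moves of Player II is legal if each of its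
members was a legal move when it was played. -/
def LegalRun (legal : List α → α → Prop) (l : List α) : Prop :=
  ∀ (h : List α) (a : α), (h ++ [a]) <+: l → legal h a

/-- The game with parameter `ξ`: Player I moves first and plays a strictly decreasing sequence of
ordinals `≤ ξ`, Player II answers with legal moves, and the first player who cannot play loses.
A strategy for Player I assigns an ordinal to each finite sequence of previous moves of Player II.
It is winning if Player I can always follow it legally, and every run in which he follows it
is finite (so that it is Player II who gets stuck). -/
structure IsWinningStrategy (legal : List α → α → Prop) (ξ : Ordinal.{0})
    (σ : List α → Ordinal.{0}) : Prop where
  first_le : σ [] ≤ ξ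
  next_lt : ∀ (h : List α) (a : α), LegalRun legal (h ++ [a]) → σ (h ++ [a]) < σ h
  finite_run : ∀ x : ℕ → α, ¬ ∀ n : ℕ, legal ((List.range n).map x) (x n)

/-- Player I has a winning strategy in the game with parameter `ξ`. -/
def PlayerIWins (legal : List α → α → Prop) (ξ : Ordinal.{0}) : Prop :=
  ∃ σ : List α → Ordinal.{0}, IsWinningStrategy legal ξ σ

end Games

/-! ### Norms on finite sets of natural numbers -/

/-- `A ≤ₛ B`: the sets have the same number of elements, and the increasing enumeration of `A`
is pointwise below that of `B`. -/
def SpreadLE (A B : Finset ℕ) : Prop :=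
  ∃ h : B.card = A.card, ∀ i : Fin A.card, A.orderEmbOfFin rfl i ≤ B.orderEmbOfFin h i

/-- Admissible norms: norms on finite sets of natural numbers that are unbounded and spreading. -/
structure IsAdmissibleNorm (nrm : Finset ℕ → ℕ) : Prop where
  empty : nrm ∅ = 0
  singleton : ∀ n, nrm {n} = 1
  mono : ∀ A B, A ⊆ B → nrm A ≤ nrm B
  union_le : ∀ A B, nrm (A ∪ B) ≤ nrm A + nrm B
  unbounded : ∀ A : Set ℕ, A.Infinite →
    Filter.Tendsto (fun n : ℕ => nrm ((Set.finite_Iio n).inter_of_right A).toFinset)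
      Filter.atTop Filter.atTop
  spreading : ∀ A B, SpreadLE A B → nrm A ≤ nrm B

/-- The moves of Player II in the game `𝒢(𝒮)`: an increasing sequence of natural numbers such that
the set of the numbers played so far is always in `𝒮`. -/
def familyGame (S : Set (Finset ℕ)) (h : List ℕ) (a : ℕ) : Prop :=
  (∀ b ∈ h, b < a) ∧ (h ++ [a]).toFinset ∈ S

/-- `ρ(𝒮)`, the least ordinal `α` such that Player I wins the game `𝒢_α(𝒮)`. -/
noncomputable def rho (S : Set (Finset ℕ)) : Ordinal.{0} :=
  sInf {α | PlayerIWins (familyGame S) α}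

/-! ### Submeasures, the exhaustivity game and the exhaustivity rank -/

section Submeasures

variable {B : Type*} [BooleanAlgebra B]

/-- Submeasures on a Boolean algebra. -/
structure IsSubmeasure (ν : B → ℝ≥0∞) : Prop where
  bot : ν ⊥ = 0
  mono : ∀ x y, x ≤ y → ν x ≤ ν y
  sup_le : ∀ x y, ν (x ⊔ y) ≤ ν x + ν y

/-- The moves of Player II in the exhaustivity game with threshold `c`: pairwise disjoint elements
of submeasure at least `c`. -/
def exhaustivityGame (ν : B → ℝ≥0∞) (c : ℝ≥0∞) (h : List B) (E : B) : Prop :=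
  (∀ D ∈ h, Disjoint D E) ∧ c ≤ ν E

/-- The finite pairwise disjoint sets of elements of submeasure at least `c`. -/
def DisjointFamily (ν : B → ℝ≥0∞) (c : ℝ≥0∞) : Type _ :=
  {F : Finset B // (F : Set B).PairwiseDisjoint id ∧ ∀ a ∈ F, c ≤ ν a}

/-- The empty family. -/
def DisjointFamily.empty (ν : B → ℝ≥0∞) (c : ℝ≥0∞) : DisjointFamily ν c :=
  ⟨∅, by simp, by simp⟩

/-- Reverse strict inclusion: `G` is below `F` if `G` properly extends `F`. -/
def DisjointFamily.Extends {ν : B → ℝ≥0∞} {c : ℝ≥0∞} (G F : DisjointFamily ν c) : Prop :=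
  F.1 ⊂ G.1

/-- The `c`-exhaustivity rank of `ν`: the rank of the empty family under reverse inclusion, where
`rank F = sup {rank G + 1 : G ⊋ F}`. It is defined when reverse inclusion is well founded. -/
noncomputable def exhaustivityRank {B : Type} [BooleanAlgebra B] (ν : B → ℝ≥0∞) (c : ℝ≥0∞)
    (h : WellFounded (DisjointFamily.Extends (ν := ν) (c := c))) : Ordinal.{0} :=
  (h.apply (DisjointFamily.empty ν c)).rank

end Submeasures

/-! ### The space `T = ∏ₙ 2ⁿ` and its clopen algebra -/

/-- The space `T = ∏ₙ {0, …, 2ⁿ - 1}`, with the product topology. -/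
abbrev T : Type := (n : ℕ) → Fin (2 ^ n)

/-- The algebra of clopen subsets of `T`. -/
abbrev ClopenAlg : Type := TopologicalSpace.Clopens T

/-- `X ∈ ℬₙ`: membership in `X` depends only on the coordinates `< n`. -/
def InLevel (n : ℕ) (X : ClopenAlg) : Prop :=
  DependsOn (fun x : T => x ∈ X) (Set.Iio n)

/-- `X` does not depend on the coordinates `< m`. -/
def IndepBelow (m : ℕ) (X : ClopenAlg) : Prop :=
  DependsOn (fun x : T => x ∈ X) (Set.Ici m)

theorem exists_inLevel (X : ClopenAlg) : ∃ n, InLevel n X := by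
  have key : ∀ x : T, ∃ n : ℕ, ∀ y ∈ PiNat.cylinder x n, (y ∈ X ↔ x ∈ X) := by
    intro x
    by_cases hx : x ∈ X
    · obtain ⟨_, ⟨z, n, rfl⟩, hxv, hv⟩ :=
        (PiNat.isTopologicalBasis_cylinders (fun n : ℕ => Fin (2 ^ n))).exists_subset_of_mem_open
          (show x ∈ (X : Set T) from hx) X.isClopen.isOpen
      refine ⟨n, fun y hy => ⟨fun _ => hx, fun _ => hv ?_⟩⟩
      rw [PiNat.mem_cylinder_iff_eq] at hxv
      rwa [← hxv]
    · obtain ⟨_, ⟨z, n, rfl⟩, hxv, hv⟩ :=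
        (PiNat.isTopologicalBasis_cylinders (fun n : ℕ => Fin (2 ^ n))).exists_subset_of_mem_open
          (show x ∈ (X : Set T)ᶜ from hx) X.isClopen.compl.isOpen
      refine ⟨n, fun y hy => ⟨fun h => ?_, fun h => absurd h hx⟩⟩
      rw [PiNat.mem_cylinder_iff_eq] at hxv
      exact absurd h (hv (by rwa [← hxv]))
  choose n hn using key
  obtain ⟨t, ht⟩ := isCompact_univ.elim_finite_subcover
    (fun x : T => PiNat.cylinder x (n x))
    (fun x => PiNat.isOpen_cylinder _ x (n x))
    (fun x _ => Set.mem_iUnion.2 ⟨x, PiNat.self_mem_cylinder x (n x)⟩)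
  refine ⟨t.sup n, fun x y hxy => propext ?_⟩
  obtain ⟨z, hz, hxz⟩ := Set.mem_iUnion₂.1 (ht (Set.mem_univ x))
  have hyz : y ∈ PiNat.cylinder z (n z) := fun i hi => by
    rw [← hxy i (lt_of_lt_of_le hi (Finset.le_sup hz))]
    exact hxz i hi
  exact (hn z x hxz).trans (hn z y hyz).symm

/-- `n(E)`, the least `n` such that `E ∈ ℬₙ`. -/
noncomputable def level (E : ClopenAlg) : ℕ := sInf {n | InLevel n E}

/-- `intₙ(X)`, the union of the atoms of `ℬₙ` contained in `X`. The atoms of `ℬₙ` are the sets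
`PiNat.cylinder u n = {y | ∀ i < n, y i = u i}`. -/
def interiorAt (n : ℕ) (X : ClopenAlg) : Set T :=
  {x | PiNat.cylinder x n ⊆ (X : Set T)}

/-- The map `π_A : T → A`, where `A = PiNat.cylinder u m`: it replaces the coordinates `< m`
by those of `u`. -/
def copyMap (m : ℕ) (u z : T) : T := fun i => if i < m then u i else z i

theorem continuous_copyMap (m : ℕ) (u : T) : Continuous (copyMap m u) := by
  refine continuous_pi fun i => ?_
  by_cases h : i < m
  · simpa [copyMap, h] using continuous_const
  · simpa [copyMap, h] using continuous_apply i

/-- `π_A⁻¹(H)`, where `A = PiNat.cylinder u m`. -/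
def copyPreimage (m : ℕ) (u : T) (H : ClopenAlg) : ClopenAlg :=
  ⟨copyMap m u ⁻¹' (H : Set T), H.isClopen.preimage (continuous_copyMap m u)⟩

/-- `X` is `(m, n, φ)`-thin: for every atom `A` of `ℬₘ` there is `H ∈ ℬₙ` such that
`H ⊆ A \ X` and `φ(π_A⁻¹(H)) > 1`. -/
def IsThinPair (φ : ClopenAlg → ℝ≥0∞) (m n : ℕ) (X : ClopenAlg) : Prop :=
  ∀ u : T, ∃ H : ClopenAlg, InLevel n H ∧ (H : Set T) ⊆ PiNat.cylinder u m \ (X : Set T) ∧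
    1 < φ (copyPreimage m u H)

/-- `X` is `(I, φ)`-thin. -/
def IsThin (φ : ClopenAlg → ℝ≥0∞) (I : Finset ℕ) (X : ClopenAlg) : Prop :=
  ∀ m ∈ I, ∀ n ∈ I, m < n → IsThinPair φ m n X

/-- The `N`-thinness property of `φ` relative to a norm, where `M` is the number `M_N`. -/
def HasThinness (nrm : Finset ℕ → ℕ) (N : ℤ) (M : ℕ) (φ : ClopenAlg → ℝ≥0∞) : Prop :=
  ∀ X : ClopenAlg, (∃ I : Finset ℕ, nrm I = M ∧ IsThin φ I X) →
    φ X ≤ ENNReal.ofReal ((2 : ℝ) ^ (-N))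

/-- `C r`, for `m < r ≤ n(E)`, is an `m`-covering sequence for `E`. Its members do not depend on
the coordinates `< m`, just as `E` itself. -/
structure IsCoveringSequence (φ : ClopenAlg → ℝ≥0∞) (m : ℕ) (E : ClopenAlg)
    (C : ℕ → ClopenAlg) : Prop where
  inLevel : ∀ r, m < r → r ≤ level E → InLevel r (C r)
  indep : ∀ r, m < r → r ≤ level E → IndepBelow m (C r)
  cover : ∀ j, m < j → j ≤ level E → interiorAt j E ⊆ ⋃ r ∈ Set.Ioc m j, (C r : Set T)
  sum_le : ∑ r ∈ Finset.Ioc m (level E), φ (C r) ≤ 4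

/-- The covering property. -/
def HasCovering (φ : ClopenAlg → ℝ≥0∞) : Prop :=
  ∀ (m : ℕ) (E : ClopenAlg), IndepBelow m E → φ E < 2 →
    ∃ C : ℕ → ClopenAlg, IsCoveringSequence φ m E C

end ExhaustivityRank

namespace ExhaustivityRank

/-! ### Natural sums of ordinals -/

/-! Player II loses once there is a clopen `G` that witnesses thinness for a set `I` of norm `M` and
meets all further moves in submeasure less than `ε`: for a move `E`, the set `E \ G` is `I`-thin, so
`ν E < 2 ^ (-N) + ε`. Such a `G` is built level by level, the levels being moves against a winning
strategy in the family game (`rankBound_of_familyGame`).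

Adding a level above `m` requires a set that is large in every atom of `ℬₘ` and almost disjoint from
all later moves. Fix one atom. If the copy of the union of the moves has submeasure at least 2, that
union serves, since later moves are disjoint from it. Otherwise the covering property gives covering
sequences of weight at most 4. Prescribe their head up to `r₀`. As long as a small tail is possible,
the complement of the head serves: it has submeasure more than 1, as `8 ≤ ν ⊤`. Once no small tail
is possible, every later covering sequence has weight more than `δ` between `r₀` and some fixed
`r₁`. There are finitely many heads up to `r₁`, and the total weight 4 allows only finitely many
repetitions (`rankBound_coverTree`).

Ranks of trees turn this into ordinals. A finite union of trees of rank `ω ^ ζ` has rank at most `ω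
^ (ζ + 1)`, and passing from one phase to the next also raises the exponent by a finite amount. Each
new level thus adds some finite `l` to the exponent, less than `ω`, and the whole count is `ω ^ (ω *
(β + 1))`. -/

/-- The natural (Hessenberg) sum of ordinals. -/
noncomputable def naturalSum (a b : Ordinal.{0}) : Ordinal.{0} :=
  max (⨆ x : Set.Iio a, Order.succ (naturalSum x.1 b))
    (⨆ x : Set.Iio b, Order.succ (naturalSum a x.1))
termination_by (a, b)
decreasing_by all_goals cases x; decreasing_tactic

theorem naturalSum_lt_left {a a' : Ordinal.{0}} (b : Ordinal.{0}) (h : a' < a) :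
    naturalSum a' b < naturalSum a b := by
  rw [naturalSum.eq_def a b]
  refine lt_max_of_lt_left ((Order.lt_succ _).trans_le ?_)
  exact Ordinal.le_iSup (fun x : Set.Iio a => Order.succ (naturalSum x.1 b)) ⟨a', h⟩

theorem naturalSum_lt_right (a : Ordinal.{0}) {b b' : Ordinal.{0}} (h : b' < b) :
    naturalSum a b' < naturalSum a b := by
  rw [naturalSum.eq_def a b]
  refine lt_max_of_lt_right ((Order.lt_succ _).trans_le ?_)
  exact Ordinal.le_iSup (fun x : Set.Iio b => Order.succ (naturalSum a x.1)) ⟨b', h⟩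

theorem naturalSum_le {a b c : Ordinal.{0}} (h₁ : ∀ a' < a, naturalSum a' b < c)
    (h₂ : ∀ b' < b, naturalSum a b' < c) : naturalSum a b ≤ c := by
  rw [naturalSum.eq_def a b]
  refine max_le (Ordinal.iSup_le fun x => ?_) (Ordinal.iSup_le fun x => ?_)
  · exact Order.succ_le_of_lt (h₁ x.1 x.2)
  · exact Order.succ_le_of_lt (h₂ x.1 x.2)

theorem exists_eq_mul_nat_add {ζ A : Ordinal.{0}} (h : A < ω ^ (ζ + 1)) :
    ∃ n : ℕ, ∃ a < ω ^ ζ, A = ω ^ ζ * n + a := by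
  have h0 : (ω ^ ζ : Ordinal.{0}) ≠ 0 := (Ordinal.opow_pos ζ Ordinal.omega0_pos).ne'
  have hd : A / ω ^ ζ < ω := by
    rwa [← Ordinal.lt_mul_iff_div_lt h0, ← Ordinal.opow_add_one]
  obtain ⟨n, hn⟩ := Ordinal.lt_omega0.1 hd
  exact ⟨n, A % ω ^ ζ, Ordinal.mod_lt _ h0, by rw [← hn, Ordinal.div_add_mod]⟩

theorem nat_le_of_mul_add_lt {ζ a a' : Ordinal.{0}} {n n' : ℕ} (ha : a < ω ^ ζ)
    (h : ω ^ ζ * n' + a' < ω ^ ζ * n + a) : n' < n ∨ n' = n ∧ a' < a := by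
  rcases lt_trichotomy n' n with hn | rfl | hn
  · exact .inl hn
  · exact .inr ⟨rfl, by simpa using h⟩
  · exfalso
    have h1 : (ω ^ ζ : Ordinal.{0}) * n + ω ^ ζ ≤ ω ^ ζ * n' := by
      have : ((n + 1 : ℕ) : Ordinal.{0}) ≤ n' := by exact_mod_cast hn
      calc (ω ^ ζ : Ordinal.{0}) * n + ω ^ ζ = ω ^ ζ * (n + 1 : ℕ) := by
            push_cast; rw [mul_add, mul_one]
        _ ≤ _ := mul_le_mul_right this _
    have h2 : (ω ^ ζ : Ordinal.{0}) * n + a < ω ^ ζ * n + ω ^ ζ := by simpa using ha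
    exact absurd (h.trans h2) (not_lt.2 (h1.trans le_self_add))

theorem mul_nat_add_lt {ζ a a' : Ordinal.{0}} {n n' : ℕ} (ha : a' < ω ^ ζ) (h : n' < n) :
    ω ^ ζ * n' + a' < ω ^ ζ * n + a := by
  have : ((n' + 1 : ℕ) : Ordinal.{0}) ≤ n := by exact_mod_cast h
  calc (ω ^ ζ : Ordinal.{0}) * n' + a' < ω ^ ζ * n' + ω ^ ζ := by simpa using ha
    _ = ω ^ ζ * (n' + 1 : ℕ) := by push_cast; rw [mul_add, mul_one]
    _ ≤ ω ^ ζ * n := mul_le_mul_right this _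
    _ ≤ _ := le_self_add

/-- Lowering an argument lowers either its coefficient or its remainder. A smaller coefficient
absorbs any natural sum of remainders, because by `hζ` that sum stays below `ω ^ ζ`. -/
theorem naturalSum_mul_nat_add_le {ζ : Ordinal.{0}}
    (hζ : ∀ a < ω ^ ζ, ∀ b < ω ^ ζ, naturalSum a b < ω ^ ζ) (n m : ℕ) (a b : Ordinal.{0})
    (ha : a < ω ^ ζ) (hb : b < ω ^ ζ) :
    naturalSum (ω ^ ζ * n + a) (ω ^ ζ * m + b) ≤ ω ^ ζ * (n + m : ℕ) + naturalSum a b := by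
  obtain ⟨A, hA⟩ : ∃ A, A = ω ^ ζ * n + a := ⟨_, rfl⟩
  obtain ⟨B, hB⟩ : ∃ B, B = ω ^ ζ * m + b := ⟨_, rfl⟩
  have hlt : ∀ (k : ℕ) (x : Ordinal.{0}), x < ω ^ ζ → ω ^ ζ * k + x < ω ^ (ζ + 1) := by
    intro k x hx
    calc ω ^ ζ * k + x < ω ^ ζ * (k + 1 : ℕ) + 0 := mul_nat_add_lt hx (Nat.lt_succ_self k)
      _ = ω ^ ζ * (k + 1 : ℕ) := add_zero _
      _ < ω ^ (ζ + 1) := Ordinal.opow_mul_lt_opow (Ordinal.natCast_lt_omega0 _) (lt_add_one ζ)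
  induction A using WellFoundedLT.induction generalizing n m a b B with
  | ind A ihA =>
    induction B using WellFoundedLT.induction generalizing n m a b with
    | ind B ihB =>
      refine naturalSum_le (fun x hx => ?_) fun y hy => ?_
      · obtain ⟨n', a', ha', rfl⟩ := exists_eq_mul_nat_add (hx.trans (hlt n a ha))
        have key := ihA _ (hA ▸ hx) n' m a' b ha' hb rfl B hB
        refine key.trans_lt ?_
        rcases nat_le_of_mul_add_lt ha hx with h | ⟨rfl, h⟩
        · exact mul_nat_add_lt (hζ _ ha' _ hb) (by omega)
        · simpa using naturalSum_lt_left b h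
      · obtain ⟨m', b', hb', rfl⟩ := exists_eq_mul_nat_add (hy.trans (hlt m b hb))
        have key := ihB _ (hB ▸ hy) n m' a b' ha hb' hA rfl
        refine key.trans_lt ?_
        rcases nat_le_of_mul_add_lt hb hy with h | ⟨rfl, h⟩
        · exact mul_nat_add_lt (hζ _ ha _ hb') (by omega)
        · simpa using naturalSum_lt_right a h

theorem naturalSum_lt_omega0_opow (ζ : Ordinal.{0}) :
    ∀ a < ω ^ ζ, ∀ b < ω ^ ζ, naturalSum a b < ω ^ ζ := by
  induction ζ using Ordinal.limitRecOn with
  | zero =>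
    intro a ha b hb
    rw [Ordinal.opow_zero, Order.lt_one_iff] at ha hb ⊢
    subst ha hb
    exact le_antisymm (naturalSum_le (fun x hx => absurd hx not_lt_zero)
      fun x hx => absurd hx not_lt_zero) zero_le
  | add_one ζ ih =>
    intro a ha b hb
    obtain ⟨n, a', ha', rfl⟩ := exists_eq_mul_nat_add ha
    obtain ⟨m, b', hb', rfl⟩ := exists_eq_mul_nat_add hb
    refine (naturalSum_mul_nat_add_le ih n m a' b' ha' hb').trans_lt ?_
    calc _ < ω ^ ζ * (n + m + 1 : ℕ) + 0 :=
          mul_nat_add_lt (ih _ ha' _ hb') (Nat.lt_succ_self (n + m))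
      _ = ω ^ ζ * (n + m + 1 : ℕ) := add_zero _
      _ < ω ^ (ζ + 1) := Ordinal.opow_mul_lt_opow (Ordinal.natCast_lt_omega0 _) (lt_add_one ζ)
  | limit ζ hζ ih =>
    intro a ha b hb
    obtain ⟨x, hx, hax⟩ := (Ordinal.lt_opow_of_isSuccLimit Ordinal.omega0_ne_zero hζ).1 ha
    obtain ⟨y, hy, hby⟩ := (Ordinal.lt_opow_of_isSuccLimit Ordinal.omega0_ne_zero hζ).1 hb
    have hmono : ∀ z, z ≤ max x y → (ω ^ z : Ordinal.{0}) ≤ ω ^ max x y := fun z hz =>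
      Ordinal.opow_le_opow_right Ordinal.omega0_pos hz
    exact (ih _ (max_lt hx hy) a (hax.trans_le (hmono x (le_max_left _ _))) b
      (hby.trans_le (hmono y (le_max_right _ _)))).trans_le
      (Ordinal.opow_le_opow_right Ordinal.omega0_pos (max_lt hx hy).le)

/-! ### Bounds for the length of games -/

section Bounds

variable {α : Type*}

/-- `IsTree Q`: the set `Q` of finite sequences is closed under initial segments. -/
def IsTree (Q : Set (List α)) : Prop := ∀ h a, h ++ [a] ∈ Q → h ∈ Q

/-- Starting from the position `h`, Player I can count down from `ξ` as long as Player II stays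
in `Q`. -/
inductive RankBound (Q : Set (List α)) : List α → Ordinal.{0} → Prop
  | intro (h : List α) (ξ : Ordinal.{0}) (η : α → Ordinal.{0})
      (lt : ∀ a, h ++ [a] ∈ Q → η a < ξ)
      (next : ∀ a, h ++ [a] ∈ Q → RankBound Q (h ++ [a]) (η a)) : RankBound Q h ξ

theorem rankBound_iff {Q : Set (List α)} {h : List α} {ξ : Ordinal.{0}} :
    RankBound Q h ξ ↔ ∀ a, h ++ [a] ∈ Q → ∃ η < ξ, RankBound Q (h ++ [a]) η := by
  constructor
  · rintro ⟨_, _, η, lt, next⟩ a ha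
    exact ⟨η a, lt a ha, next a ha⟩
  · intro H
    choose! η h1 h2 using H
    exact ⟨h, ξ, η, h1, h2⟩

theorem RankBound.mono {Q : Set (List α)} {h : List α} {ξ ξ' : Ordinal.{0}}
    (H : RankBound Q h ξ) (hle : ξ ≤ ξ') : RankBound Q h ξ' := by
  rw [rankBound_iff] at H ⊢
  intro a ha
  obtain ⟨η, hη, h'⟩ := H a ha
  exact ⟨η, hη.trans_le hle, h'⟩

theorem RankBound.anti {Q Q' : Set (List α)} {h : List α} {ξ : Ordinal.{0}}
    (H : RankBound Q h ξ) (hQ : ∀ k, h <+: k → k ∈ Q' → k ∈ Q) : RankBound Q' h ξ := by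
  induction H with
  | intro h ξ η lt _ ih =>
    have hp : ∀ a, h <+: h ++ [a] := fun a => List.prefix_append h [a]
    exact ⟨h, ξ, η, fun a ha => lt a (hQ _ (hp a) ha), fun a ha =>
      ih a (hQ _ (hp a) ha) fun k hk => hQ k ((hp a).trans hk)⟩

theorem rankBound_of_forall_notMem {Q : Set (List α)} {h : List α} (ξ : Ordinal.{0})
    (H : ∀ a, h ++ [a] ∉ Q) : RankBound Q h ξ :=
  rankBound_iff.2 fun a ha => absurd ha (H a)

/-- The countdown uses `ξ` inside `Q'` and `η` after leaving it; the later phase stands on the left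
of the sum, and the 1 pays for the exit move. -/
theorem RankBound.of_exit {Q Q' : Set (List α)} {h : List α} {ξ η : Ordinal.{0}}
    (H : RankBound Q' h ξ)
    (hexit : ∀ k, h <+: k → k ∈ Q → k ∉ Q' → RankBound Q k η) :
    RankBound Q h (η + 1 + ξ) := by
  induction H with
  | intro h ξ θ lt _ ih =>
    rw [rankBound_iff]
    intro a ha
    by_cases ha' : h ++ [a] ∈ Q'
    · exact ⟨η + 1 + θ a, by simpa using lt a ha',
        ih a ha' fun k hk => hexit k ((List.prefix_append h [a]).trans hk)⟩
    · exact ⟨η, (lt_add_one η).trans_le le_self_add,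
        hexit _ (List.prefix_append h [a]) ha ha'⟩

/-- Each move in the union decreases a summand for every tree it stays in. A tree that has been left
is never re-entered, so its bound then holds vacuously. -/
theorem RankBound.union {Q Q' : Set (List α)} (hQ : IsTree Q) (hQ' : IsTree Q')
    {h : List α} {ξ η : Ordinal.{0}} (H : RankBound Q h ξ) (H' : RankBound Q' h η) :
    RankBound (Q ∪ Q') h (naturalSum ξ η) := by
  induction ξ using WellFoundedLT.induction generalizing h η with
  | ind ξ ihξ =>
    induction η using WellFoundedLT.induction generalizing h with
    | ind η ihη =>
      rw [rankBound_iff] at H H' ⊢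
      intro a ha
      by_cases h1 : h ++ [a] ∈ Q
      · obtain ⟨θ, hθ, hb⟩ := H a h1
        by_cases h2 : h ++ [a] ∈ Q'
        · obtain ⟨θ', hθ', hb'⟩ := H' a h2
          exact ⟨_, (naturalSum_lt_left θ' hθ).trans (naturalSum_lt_right ξ hθ'),
            ihξ θ hθ hb hb'⟩
        · exact ⟨_, naturalSum_lt_left η hθ,
            ihξ θ hθ hb (rankBound_of_forall_notMem η fun b hb => h2 (hQ' _ _ hb))⟩
      · obtain ⟨θ', hθ', hb'⟩ := H' a (ha.resolve_left h1)
        exact ⟨_, naturalSum_lt_right ξ hθ', ihη θ' hθ'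
          (rankBound_of_forall_notMem ξ fun b hb => h1 (hQ _ _ hb)) hb'⟩

theorem RankBound.iUnion {ι : Type*} [Finite ι] {Q : ι → Set (List α)}
    (hQ : ∀ i, IsTree (Q i)) {h : List α} {ζ : Ordinal.{0}}
    (H : ∀ i, RankBound (Q i) h (ω ^ ζ)) : RankBound (⋃ i, Q i) h (ω ^ (ζ + 1)) := by
  classical
  have := Fintype.ofFinite ι
  have htree : ∀ s : Finset ι, IsTree (⋃ i ∈ s, Q i) := by
    intro s k a hk
    simp only [Set.mem_iUnion] at hk ⊢
    obtain ⟨i, hi, hk⟩ := hk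
    exact ⟨i, hi, hQ i _ _ hk⟩
  have key : ∀ s : Finset ι, ∃ ξ < ω ^ (ζ + 1), RankBound (⋃ i ∈ s, Q i) h ξ := by
    intro s
    induction s using Finset.induction_on with
    | empty =>
      exact ⟨0, Ordinal.opow_pos _ Ordinal.omega0_pos,
        rankBound_of_forall_notMem 0 fun a ha => by simp at ha⟩
    | insert i s _ ih =>
      obtain ⟨ξ, hξ, hb⟩ := ih
      refine ⟨naturalSum (ω ^ ζ) ξ, naturalSum_lt_omega0_opow _ _ ?_ _ hξ, ?_⟩
      · exact (Ordinal.opow_lt_opow_iff_right Ordinal.one_lt_omega0).2 (lt_add_one ζ)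
      · rw [Finset.set_biUnion_insert]
        exact (H i).union (hQ i) (htree s) hb
  obtain ⟨ξ, hξ, hb⟩ := key Finset.univ
  exact (hb.mono hξ.le).anti (by simp)

theorem rankBound_of_exit_opow {Q Q' : Set (List α)} {h : List α} {ζ ξ η : Ordinal.{0}}
    (hξ : ξ < ζ) (hη : η < ζ) (H : RankBound Q' h (ω ^ ξ))
    (hexit : ∀ k, h <+: k → k ∈ Q → k ∉ Q' → RankBound Q k (ω ^ η)) :
    RankBound Q h (ω ^ ζ) := by
  have hlt : ∀ x < ζ, (ω ^ x : Ordinal.{0}) < ω ^ ζ := fun x hx =>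
    (Ordinal.opow_lt_opow_iff_right Ordinal.one_lt_omega0).2 hx
  have hp := Ordinal.isPrincipal_add_omega0_opow ζ
  refine (H.of_exit hexit).mono (le_of_lt (hp (hp (hlt _ hη) ?_) (hlt _ hξ)))
  exact Ordinal.one_lt_opow.2 ⟨Ordinal.one_lt_omega0, (bot_le.trans_lt hξ).ne'⟩

theorem LegalRun.isTree (legal : List α → α → Prop) : IsTree {h | LegalRun legal h} :=
  fun h a H k b hk => H k b (hk.trans (List.prefix_append h [a]))

theorem legalRun_append_singleton {legal : List α → α → Prop} {h : List α} {a : α} :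
    LegalRun legal (h ++ [a]) ↔ LegalRun legal h ∧ legal h a := by
  refine ⟨fun H => ⟨LegalRun.isTree legal h a H, H h a (List.prefix_refl _)⟩, ?_⟩
  rintro ⟨H, ha⟩ k b hk
  rcases List.prefix_concat_iff.1 hk with hk | hk
  · obtain ⟨rfl, hb⟩ := List.append_inj' hk rfl
    obtain rfl : b = a := by simpa using hb
    exact ha
  · exact H k b hk

/-- Player I always plays the least rank bound of the current position. -/
theorem RankBound.playerIWins {legal : List α → α → Prop} {ξ : Ordinal.{0}}
    (H : RankBound {h | LegalRun legal h} [] ξ) : PlayerIWins legal ξ := by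
  set Q := {h | LegalRun legal h}
  have hex : ∀ h ∈ Q, ∃ η, RankBound Q h η := by
    intro h
    induction h using List.reverseRecOn with
    | nil => exact fun _ => ⟨ξ, H⟩
    | append_singleton h a ih =>
      intro ha
      obtain ⟨η, hη⟩ := ih (LegalRun.isTree legal h a ha)
      obtain ⟨θ, -, hθ⟩ := rankBound_iff.1 hη a ha
      exact ⟨θ, hθ⟩
  have hlt : ∀ h a, h ++ [a] ∈ Q →
      sInf {η | RankBound Q (h ++ [a]) η} < sInf {η | RankBound Q h η} := by
    intro h a ha
    obtain ⟨θ, hθ, hb⟩ := rankBound_iff.1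
      (csInf_mem (s := {η | RankBound Q h η}) (hex h (LegalRun.isTree legal h a ha))) a ha
    exact (csInf_le' hb).trans_lt hθ
  refine ⟨fun h => sInf {η | RankBound Q h η}, csInf_le' H, hlt, fun x hx => ?_⟩
  have hrun : ∀ n, (List.range n).map x ∈ Q := by
    intro n
    induction n with
    | zero => intro h a hk; simp at hk
    | succ n ih =>
      rw [List.range_succ, List.map_append]
      exact legalRun_append_singleton.2 ⟨ih, hx n⟩
  refine (RelEmbedding.natGT (r := (· < ·))
    (fun n => sInf {η | RankBound Q ((List.range n).map x) η}) fun n => ?_).not_wellFounded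
    Ordinal.lt_wf
  have := hlt ((List.range n).map x) (x n)
  simp only [List.range_succ, List.map_append, List.map_cons, List.map_nil]
  refine this ?_
  simpa [List.range_succ] using hrun (n + 1)

theorem exists_playerIWins {α : Type} {legal : List α → α → Prop}
    (hfin : ∀ x : ℕ → α, ¬ ∀ n : ℕ, legal ((List.range n).map x) (x n)) :
    ∃ ξ, PlayerIWins legal ξ := by
  let r : List α → List α → Prop := fun k h =>
    LegalRun legal k ∧ ∃ a, k = h ++ [a]
  have hwf : WellFounded r := by
    rw [wellFounded_iff_isEmpty_descending_chain]
    refine ⟨fun ⟨f, hf⟩ => ?_⟩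
    choose hleg a ha using hf
    -- A descending chain may start at a nonempty position, so the infinite run first replays `f 0`.
    let y : ℕ → α := fun n => if h : n < (f 0).length then (f 0)[n] else a (n - (f 0).length)
    have hy : ∀ n, (List.range ((f 0).length + n)).map y = f n := by
      intro n
      induction n with
      | zero =>
        apply List.ext_getElem
        · simp
        · intro i h1 h2
          simp [y, h2]
      | succ n ih =>
        rw [← add_assoc, List.range_succ, List.map_append, ih, ha n]
        simp [y]
    refine hfin y fun n => ?_
    refine hleg n _ _ ?_
    have h1 : (List.range n).map y ++ [y n] = (List.range (n + 1)).map y := by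
      simp [List.range_succ]
    rw [h1, ← hy (n + 1)]
    refine List.IsPrefix.map y ?_
    rw [show (f 0).length + (n + 1) = (n + 1) + (f 0).length by omega,
      List.range_add (n := n + 1)]
    exact List.prefix_append _ _
  refine ⟨(hwf.apply []).rank, fun h => (hwf.apply h).rank, le_rfl, fun h a ha => ?_, hfin⟩
  exact Acc.rank_lt_of_rel _ ⟨ha, a, rfl⟩

end Bounds

/-! ### From winning strategies to the exhaustivity rank -/

section RankOfFamilies

variable {B : Type} [BooleanAlgebra B]

theorem legalRun_exhaustivityGame {ν : B → ℝ≥0∞} {c : ℝ≥0∞} {l : List B}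
    (h1 : l.Pairwise Disjoint) (h2 : ∀ a ∈ l, c ≤ ν a) :
    LegalRun (exhaustivityGame ν c) l := by
  rintro h a ⟨t, rfl⟩
  rw [List.append_assoc, List.pairwise_append] at h1
  exact ⟨fun D hD => h1.2.2 D hD a (by simp), h2 a (by simp)⟩

theorem IsWinningStrategy.lt_of_prefix {α : Type*} {legal : List α → α → Prop}
    {ξ : Ordinal.{0}} {σ : List α → Ordinal.{0}} (hσ : IsWinningStrategy legal ξ σ)
    (h l : List α) (hl : l ≠ []) (hleg : LegalRun legal (h ++ l)) : σ (h ++ l) < σ h := by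
  induction l using List.reverseRecOn with
  | nil => exact absurd rfl hl
  | append_singleton l a ih =>
    rw [← List.append_assoc] at hleg ⊢
    have h1 := hσ.next_lt _ _ hleg
    rcases eq_or_ne l [] with rfl | hne
    · simpa using h1
    · exact h1.trans (ih hne (LegalRun.isTree legal _ _ hleg))

/-- A larger family `G` is reached by playing `G \ F` in any order after an enumeration `l` of `F`,
and this lowers the ordinal of the strategy. -/
theorem IsWinningStrategy.acc_rank_le {ν : B → ℝ≥0∞} {c : ℝ≥0∞}
    {ξ : Ordinal.{0}} {σ : List B → Ordinal.{0}}
    (hσ : IsWinningStrategy (exhaustivityGame ν c) ξ σ) (l : List B)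
    (F : DisjointFamily ν c) (hl : l.Nodup) (hF : ∀ a, a ∈ l ↔ a ∈ F.1) :
    ∃ h : Acc DisjointFamily.Extends F, h.rank ≤ σ l := by
  classical
  obtain ⟨o, ho⟩ : ∃ o, o = σ l := ⟨_, rfl⟩
  induction o using WellFoundedLT.induction generalizing l F with
  | ind o ih =>
    have key : ∀ G : DisjointFamily ν c, G.Extends F →
        ∃ h : Acc DisjointFamily.Extends G, h.rank < σ l := by
      intro G hG
      set l' := (G.1 \ F.1).toList
      have hmem : ∀ a, a ∈ l ++ l' ↔ a ∈ G.1 := by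
        intro a
        simp only [List.mem_append, hF, l', Finset.mem_toList, Finset.mem_sdiff]
        have := @hG.1 a
        tauto
      have hnd : (l ++ l').Nodup := by
        refine List.nodup_append.2 ⟨hl, Finset.nodup_toList _, ?_⟩
        rintro a ha b hb rfl
        simp only [l', Finset.mem_toList, Finset.mem_sdiff] at hb
        exact hb.2 ((hF a).1 ha)
      have hpw : (l ++ l').Pairwise Disjoint := by
        refine hnd.imp_of_mem fun {a b} ha hb hab => ?_
        exact G.2.1 ((hmem a).1 ha) ((hmem b).1 hb) hab
      have hlt : σ (l ++ l') < σ l := by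
        refine hσ.lt_of_prefix l l' ?_ (legalRun_exhaustivityGame hpw fun a ha =>
          G.2.2 a ((hmem a).1 ha))
        simp only [l', ne_eq, Finset.toList_eq_nil, Finset.sdiff_eq_empty_iff_subset]
        exact hG.2
      obtain ⟨hacc, hr⟩ := ih _ (ho ▸ hlt) (l ++ l') G hnd hmem rfl
      exact ⟨hacc, hr.trans_lt hlt⟩
    have hacc : Acc DisjointFamily.Extends F := ⟨F, fun G hG => (key G hG).1⟩
    refine ⟨hacc, ?_⟩
    rw [Acc.rank_eq]
    refine Ordinal.iSup_le fun G => Order.succ_le_of_lt ?_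
    exact (key G.1 G.2).2

theorem PlayerIWins.exhaustivityRank_le {ν : B → ℝ≥0∞} {c : ℝ≥0∞}
    {ξ : Ordinal.{0}} (H : PlayerIWins (exhaustivityGame ν c) ξ) :
    ∃ hwf : WellFounded (DisjointFamily.Extends (ν := ν) (c := c)),
      exhaustivityRank ν c hwf ≤ ξ := by
  obtain ⟨σ, hσ⟩ := H
  have hwf : WellFounded (DisjointFamily.Extends (ν := ν) (c := c)) :=
    ⟨fun F => (hσ.acc_rank_le F.1.toList F (Finset.nodup_toList _) (by simp)).1⟩
  obtain ⟨_, h⟩ := hσ.acc_rank_le [] (DisjointFamily.empty ν c) (by simp)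
    (by simp [DisjointFamily.empty])
  exact ⟨hwf, h.trans hσ.first_le⟩

end RankOfFamilies

/-! ### The families of sets of small norm -/

section Norm

theorem toFinset_map_range (x : ℕ → ℕ) (n : ℕ) :
    ((List.range n).map x).toFinset = (Finset.range n).image x := by
  ext; simp

/-- The infimum is attained because some ordinal wins: an infinite run would enumerate an infinite
set whose initial segments all have norm below `M`. -/
theorem rho_spec {nrm : Finset ℕ → ℕ} (hnrm : IsAdmissibleNorm nrm) (M : ℕ) :
    PlayerIWins (familyGame {F | nrm F < M}) (rho {F | nrm F < M}) := by
  refine csInf_mem (s := {α | PlayerIWins (familyGame {F | nrm F < M}) α})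
    (exists_playerIWins fun x hx => ?_)
  have hmono : StrictMono x := strictMono_nat_of_lt_succ fun n =>
    (hx (n + 1)).1 (x n) (List.mem_map.2 ⟨n, by simp, rfl⟩)
  obtain ⟨n, hn⟩ := ((hnrm.unbounded _ (Set.infinite_range_of_injective hmono.injective)).eventually
    (Filter.eventually_ge_atTop M)).exists
  have h1 := (hx n).2
  have h2 : (List.map x (List.range n) ++ [x n]).toFinset = (Finset.range (n + 1)).image x := by
    rw [← toFinset_map_range, List.range_succ, List.map_append]; rfl
  rw [h2, Set.mem_ofPred_eq] at h1
  refine absurd (hn.trans (hnrm.mono _ _ ?_)) (not_le.2 h1)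
  intro y hy
  simp only [Set.Finite.mem_toFinset, Set.mem_inter_iff, Set.mem_range, Set.mem_Iio] at hy
  obtain ⟨⟨i, rfl⟩, hi⟩ := hy
  refine Finset.mem_image_of_mem x (Finset.mem_range.2 ?_)
  have := hmono.id_le i
  simp at this
  omega

end Norm

/-! ### The clopen algebra -/

section Clopen

theorem InLevel.mono {m n : ℕ} {X : ClopenAlg} (h : InLevel m X) (hmn : m ≤ n) : InLevel n X :=
  DependsOn.mono (Set.Iio_subset_Iio hmn) h

theorem inLevel_iff {n : ℕ} {X : ClopenAlg} :
    InLevel n X ↔ ∀ x y : T, (∀ i < n, x i = y i) → x ∈ X → y ∈ X := by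
  constructor
  · exact fun h x y hxy hx => (h (x := x) (y := y) hxy).mp hx
  · intro h x y hxy
    exact propext ⟨h x y hxy, h y x fun i hi => (hxy i hi).symm⟩

theorem indepBelow_iff {m : ℕ} {X : ClopenAlg} :
    IndepBelow m X ↔ ∀ x y : T, (∀ i, m ≤ i → x i = y i) → x ∈ X → y ∈ X := by
  constructor
  · exact fun h x y hxy hx => (h (x := x) (y := y) hxy).mp hx
  · intro h x y hxy
    exact propext ⟨h x y hxy, h y x fun i hi => (hxy i hi).symm⟩

theorem inLevel_level (X : ClopenAlg) : InLevel (level X) X :=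
  csInf_mem (s := {n | InLevel n X}) (exists_inLevel X)

theorem InLevel.sup {n : ℕ} {X Y : ClopenAlg} (hX : InLevel n X) (hY : InLevel n Y) :
    InLevel n (X ⊔ Y) := by
  rw [inLevel_iff] at *
  exact fun x y hxy => Or.imp (hX x y hxy) (hY x y hxy)

theorem InLevel.inf {n : ℕ} {X Y : ClopenAlg} (hX : InLevel n X) (hY : InLevel n Y) :
    InLevel n (X ⊓ Y) := by
  rw [inLevel_iff] at *
  exact fun x y hxy => And.imp (hX x y hxy) (hY x y hxy)

theorem InLevel.compl {n : ℕ} {X : ClopenAlg} (hX : InLevel n X) : InLevel n Xᶜ := by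
  rw [inLevel_iff] at *
  exact fun x y hxy hx hy => hx (hX y x (fun i hi => (hxy i hi).symm) hy)

theorem inLevel_bot (n : ℕ) : InLevel n ⊥ := inLevel_iff.2 fun _ _ _ h => h

theorem InLevel.finset_sup {ι : Type*} {n : ℕ} {s : Finset ι} {C : ι → ClopenAlg}
    (h : ∀ i ∈ s, InLevel n (C i)) : InLevel n (s.sup C) :=
  Finset.sup_induction (p := InLevel n) (inLevel_bot n) (fun _ ha _ hb => ha.sup hb) h

theorem mem_finset_sup {ι : Type*} {s : Finset ι} {C : ι → ClopenAlg} {x : T} :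
    x ∈ s.sup C ↔ ∃ i ∈ s, x ∈ C i := by
  classical
  induction s using Finset.induction_on with
  | empty =>
    simp only [Finset.sup_empty, Finset.notMem_empty, false_and, exists_false]
    exact Iff.rfl
  | insert i s _ ih =>
    rw [Finset.sup_insert, Finset.exists_mem_insert, ← ih]
    exact Iff.rfl

/-- The atom of `ℬₘ` that contains `u`. -/
def atom (m : ℕ) (u : T) : ClopenAlg :=
  ⟨PiNat.cylinder u m, by
    refine ⟨⟨?_⟩, PiNat.isOpen_cylinder _ u m⟩
    have : (PiNat.cylinder u m)ᶜ = ⋃ y ∈ (PiNat.cylinder u m)ᶜ, PiNat.cylinder y m := by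
      ext x
      simp only [Set.mem_iUnion]
      refine ⟨fun hx => ⟨x, hx, PiNat.self_mem_cylinder x m⟩, ?_⟩
      rintro ⟨y, hy, hxy⟩ hxu
      exact hy fun i hi => (hxy i hi).symm.trans (hxu i hi)
    rw [this]
    exact isOpen_biUnion fun y _ => PiNat.isOpen_cylinder _ y m⟩

theorem inLevel_atom (m : ℕ) (u : T) : InLevel m (atom m u) :=
  inLevel_iff.2 fun _ _ hxy hx i hi => (hxy i hi).symm.trans (hx i hi)

theorem mem_copyPreimage {m : ℕ} {u x : T} {H : ClopenAlg} :
    x ∈ copyPreimage m u H ↔ copyMap m u x ∈ H := Iff.rfl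

theorem copyMap_mem_atom (m : ℕ) (u x : T) : copyMap m u x ∈ atom m u :=
  fun i hi => by simp [copyMap, hi]

theorem copyMap_eq_self {m : ℕ} {u x : T} (h : x ∈ atom m u) : copyMap m u x = x := by
  funext i
  by_cases hi : i < m
  · simp [copyMap, hi, h i hi]
  · simp [copyMap, hi]

theorem copyMap_congr {m : ℕ} {u v : T} (h : ∀ i < m, u i = v i) : copyMap m u = copyMap m v := by
  funext x i
  by_cases hi : i < m
  · simp [copyMap, hi, h i hi]
  · simp [copyMap, hi]

theorem copyPreimage_congr {m : ℕ} {u v : T} (h : ∀ i < m, u i = v i) (H : ClopenAlg) :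
    copyPreimage m u H = copyPreimage m v H :=
  SetLike.ext fun x => by rw [mem_copyPreimage, mem_copyPreimage, copyMap_congr h]

theorem copyPreimage_mono (m : ℕ) (u : T) {G H : ClopenAlg} (h : G ≤ H) :
    copyPreimage m u G ≤ copyPreimage m u H := fun _ hx => h hx

theorem copyPreimage_inf_atom (m : ℕ) (u : T) (H : ClopenAlg) :
    copyPreimage m u (H ⊓ atom m u) = copyPreimage m u H :=
  SetLike.ext fun x => by
    rw [mem_copyPreimage, mem_copyPreimage]
    exact ⟨fun h => h.1, fun h => ⟨h, copyMap_mem_atom m u x⟩⟩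

theorem indepBelow_copyPreimage (m : ℕ) (u : T) (H : ClopenAlg) :
    IndepBelow m (copyPreimage m u H) := by
  rw [indepBelow_iff]
  intro x y hxy hx
  rw [mem_copyPreimage] at *
  convert hx using 1
  funext i
  by_cases hi : i < m
  · simp [copyMap, hi]
  · simp [copyMap, hi, hxy i (not_lt.1 hi)]

theorem copyMap_mem_iff {m : ℕ} {X : ClopenAlg} (h : IndepBelow m X) (u x : T) :
    copyMap m u x ∈ X ↔ x ∈ X := by
  have : ∀ i, m ≤ i → copyMap m u x i = x i := fun i hi => by simp [copyMap, not_lt.2 hi]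
  rw [indepBelow_iff] at h
  exact ⟨h _ _ this, h _ _ fun i hi => (this i hi).symm⟩

theorem interiorAt_subset (n : ℕ) (X : ClopenAlg) : interiorAt n X ⊆ (X : Set T) :=
  fun x hx => hx (PiNat.self_mem_cylinder x n)

theorem interiorAt_mono {X Y : ClopenAlg} (n : ℕ) (h : X ≤ Y) : interiorAt n X ⊆ interiorAt n Y :=
  fun _ hx => Set.Subset.trans hx h

theorem mem_interiorAt {n : ℕ} {X : ClopenAlg} (h : InLevel n X) {x : T} (hx : x ∈ X) :
    x ∈ interiorAt n X :=
  fun y hy => inLevel_iff.1 h x y (fun i hi => (hy i hi).symm) hx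

/-- Extension of the coordinates `< n` by zeros. -/
def extendZero (n : ℕ) (p : (i : Fin n) → Fin (2 ^ (i : ℕ))) : T :=
  fun i => if h : i < n then p ⟨i, h⟩ else 0

theorem extendZero_apply {n i : ℕ} (x : T) (h : i < n) : extendZero n (fun j => x j) i = x i := by
  simp [extendZero, h]

/-- This makes the number of possible heads of covering sequences finite. -/
instance finite_inLevel (n : ℕ) : Finite {X : ClopenAlg // InLevel n X} := by
  refine Finite.of_injective (fun X => {p | extendZero n p ∈ X.1}) fun X Y hXY => ?_
  have key : ∀ Z : {X : ClopenAlg // InLevel n X}, ∀ x : T,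
      x ∈ Z.1 ↔ (fun j : Fin n => x j) ∈ {p | extendZero n p ∈ Z.1} := by
    intro Z x
    have h := inLevel_iff.1 Z.2
    exact ⟨h _ _ fun i hi => (extendZero_apply x hi).symm, h _ _ fun i hi => extendZero_apply x hi⟩
  refine Subtype.ext (SetLike.ext fun x => ?_)
  rw [key X, key Y]
  exact iff_of_eq (congrArg (fun s => (fun j : Fin n => x j) ∈ s) hXY)

theorem exists_atom_representatives (m : ℕ) :
    ∃ t : Finset T, ∀ x : T, ∃ u ∈ t, ∀ i < m, u i = x i := by
  classical
  refine ⟨Finset.univ.image (extendZero m), fun x => ⟨_, Finset.mem_image_of_mem _ (Finset.mem_univ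
    (fun j : Fin m => x j)), fun i hi => extendZero_apply x hi⟩⟩

theorem copyPreimage_eq_self {m : ℕ} {X : ClopenAlg} (h : IndepBelow m X) (u : T) :
    copyPreimage m u X = X :=
  SetLike.ext fun x => copyMap_mem_iff h u x

theorem IndepBelow.compl {m : ℕ} {X : ClopenAlg} (h : IndepBelow m X) : IndepBelow m Xᶜ := by
  rw [indepBelow_iff] at *
  exact fun x y hxy hx hy => hx (h y x (fun i hi => (hxy i hi).symm) hy)

theorem IndepBelow.finset_sup {ι : Type*} {m : ℕ} {s : Finset ι} {C : ι → ClopenAlg}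
    (h : ∀ i ∈ s, IndepBelow m (C i)) : IndepBelow m (s.sup C) := by
  rw [indepBelow_iff]
  intro x y hxy hx
  obtain ⟨i, hi, hx⟩ := mem_finset_sup.1 hx
  exact mem_finset_sup.2 ⟨i, hi, indepBelow_iff.1 (h i hi) x y hxy hx⟩

theorem IsSubmeasure.finset_sup_le {B : Type*} [BooleanAlgebra B] {ν : B → ℝ≥0∞}
    (hν : IsSubmeasure ν) {ι : Type*} (s : Finset ι) (C : ι → B) :
    ν (s.sup C) ≤ ∑ i ∈ s, ν (C i) := by
  classical
  induction s using Finset.induction_on with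
  | empty => simp [hν.bot]
  | insert i s hi ih =>
    rw [Finset.sup_insert, Finset.sum_insert hi]
    exact (hν.sup_le _ _).trans (by gcongr)

end Clopen

/-! ### Infinite covering sequences -/

section Covering

/-- A covering sequence for `E` above `m` that is indexed by all `r > m`. -/
structure IsFullCovering (ν : ClopenAlg → ℝ≥0∞) (m : ℕ) (E : ClopenAlg) (C : ℕ → ClopenAlg) :
    Prop where
  inLevel : ∀ r, m < r → InLevel r (C r)
  indep : ∀ r, m < r → IndepBelow m (C r)
  cover : ∀ j, m < j → ∀ x ∈ interiorAt j E, ∃ r ∈ Finset.Ioc m j, x ∈ C r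
  sum_le : ∀ R, ∑ r ∈ Finset.Ioc m R, ν (C r) ≤ 4

theorem IsFullCovering.anti {ν : ClopenAlg → ℝ≥0∞} {m : ℕ} {E E' : ClopenAlg}
    {C : ℕ → ClopenAlg} (h : IsFullCovering ν m E C) (hE : E' ≤ E) : IsFullCovering ν m E' C :=
  { h with cover := fun j hj x hx => h.cover j hj x (interiorAt_mono j hE hx) }

/-- Beyond a level `R` containing `E` the interiors of `E` no longer grow, so later terms are
superfluous. A bound on the weight up to `R` then controls the whole tail. -/
theorem IsFullCovering.truncate {ν : ClopenAlg → ℝ≥0∞} (hν : IsSubmeasure ν) {m R : ℕ}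
    {E : ClopenAlg} {C : ℕ → ClopenAlg} (h : IsFullCovering ν m E C) (hm : m < R)
    (hE : InLevel R E) :
    IsFullCovering ν m E (fun r => if r ≤ R then C r else ⊥) where
  inLevel r hr := by
    split_ifs
    · exact h.inLevel r hr
    · exact inLevel_bot r
  indep r hr := by
    split_ifs
    · exact h.indep r hr
    · exact indepBelow_iff.2 fun _ _ _ hx => hx
  cover j hj x hx := by
    obtain ⟨r, hr, hxr⟩ := h.cover (min j R) (lt_min hj hm) x (by
      rcases le_total j R with hjR | hjR
      · rwa [min_eq_left hjR]
      · rw [min_eq_right hjR]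
        exact mem_interiorAt hE (interiorAt_subset j E hx))
    rw [Finset.mem_Ioc, le_min_iff] at hr
    exact ⟨r, Finset.mem_Ioc.2 ⟨hr.1, hr.2.1⟩, by rwa [if_pos hr.2.2]⟩
  sum_le S := by
    refine le_trans (Finset.sum_le_sum fun r _ => ?_) (h.sum_le S)
    split_ifs
    · exact le_rfl
    · rw [hν.bot]; exact zero_le

theorem eq_bot_of_indepBelow {ν : ClopenAlg → ℝ≥0∞} (hT : 8 ≤ ν ⊤) {m : ℕ} {E : ClopenAlg}
    (h1 : IndepBelow m E) (h2 : InLevel m E) (h3 : ν E < 2) : E = ⊥ := by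
  by_contra hne
  have hex : ∃ x, x ∈ E := by
    by_contra hno
    push Not at hno
    exact hne (SetLike.ext fun x => ⟨fun hx => absurd hx (hno x),
      fun hx => absurd hx (Set.notMem_empty x)⟩)
  obtain ⟨x, hx⟩ := hex
  have htop : E = ⊤ := by
    refine SetLike.ext fun y => ⟨fun _ => Set.mem_univ y, fun _ => ?_⟩
    refine (copyMap_mem_iff h1 x y).1 ?_
    exact inLevel_iff.1 h2 x _ (fun i hi => by simp [copyMap, hi]) hx
  rw [htop] at h3
  exact absurd (hT.trans_lt h3) (by norm_num)

theorem HasCovering.exists_isFullCovering {ν : ClopenAlg → ℝ≥0∞} (hν : IsSubmeasure ν)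
    (hcov : HasCovering ν) (hT : 8 ≤ ν ⊤) {m : ℕ} {E : ClopenAlg} (h1 : IndepBelow m E)
    (h2 : ν E < 2) : ∃ C, IsFullCovering ν m E C := by
  obtain ⟨C, hC⟩ := hcov m E h1 h2
  refine ⟨fun r => if r ≤ level E then C r else ⊥, ?_, ?_, ?_, ?_⟩
  · intro r hr
    split_ifs with h
    · exact hC.inLevel r hr h
    · exact inLevel_bot r
  · intro r hr
    split_ifs with h
    · exact hC.indep r hr h
    · exact indepBelow_iff.2 fun _ _ _ hx => hx
  · intro j hj x hx
    have hxE := interiorAt_subset j E hx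
    -- If `level E ≤ m`, the given sequence has no terms; then `E` is empty or all of `T`, and `8 ≤
    -- ν ⊤` excludes the latter.
    rcases le_or_gt (level E) m with hm | hm
    · rw [eq_bot_of_indepBelow hT h1 ((inLevel_level E).mono hm) h2] at hxE
      exact absurd hxE (Set.notMem_empty x)
    · have := hC.cover (min j (level E)) (lt_min hj hm) (min_le_right _ _) (by
        rcases le_total j (level E) with hjR | hjR
        · rwa [min_eq_left hjR]
        · rw [min_eq_right hjR]
          exact mem_interiorAt (inLevel_level E) hxE)
      simp only [Set.mem_iUnion, Set.mem_Ioc, le_min_iff] at this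
      obtain ⟨r, ⟨hr1, hr2, hr3⟩, hxr⟩ := this
      exact ⟨r, Finset.mem_Ioc.2 ⟨hr1, hr2⟩, by rwa [if_pos hr3]⟩
  · intro R
    calc ∑ r ∈ Finset.Ioc m R, ν (if r ≤ level E then C r else ⊥)
        = ∑ r ∈ (Finset.Ioc m R).filter (· ≤ level E), ν (C r) := by
          rw [Finset.sum_filter]
          refine Finset.sum_congr rfl fun r _ => ?_
          split_ifs
          · rfl
          · exact hν.bot
      _ ≤ ∑ r ∈ Finset.Ioc m (level E), ν (C r) := by
          refine Finset.sum_le_sum_of_subset fun r hr => ?_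
          simp only [Finset.mem_filter, Finset.mem_Ioc] at hr ⊢
          exact ⟨hr.1.1, hr.2⟩
      _ ≤ 4 := hC.sum_le

end Covering

/-! ### Settling the atoms of one level by covering sequences -/

section Settling

/-- The union of the moves in a finite sequence. -/
def historyUnion (h : List ClopenAlg) : ClopenAlg := h.foldr (· ⊔ ·) ⊥

theorem mem_historyUnion {h : List ClopenAlg} {x : T} :
    x ∈ historyUnion h ↔ ∃ E ∈ h, x ∈ E := by
  induction h with
  | nil => simp only [historyUnion, List.foldr_nil, List.not_mem_nil, false_and, exists_false]
           exact Iff.rfl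
  | cons E h ih =>
    rw [List.exists_mem_cons_iff, ← ih]
    exact Iff.rfl

theorem historyUnion_mono {h k : List ClopenAlg} (hk : h <+: k) :
    historyUnion h ≤ historyUnion k := by
  intro x hx
  obtain ⟨E, hE, hx⟩ := mem_historyUnion.1 hx
  exact mem_historyUnion.2 ⟨E, hk.subset hE, hx⟩

/-- After the position `h`, the moves in `Q` meet `G` in a set of submeasure at most `δ`. -/
def Settles (ν : ClopenAlg → ℝ≥0∞) (δ : ℝ≥0∞) (G : ClopenAlg) (Q : Set (List ClopenAlg))
    (h : List ClopenAlg) : Prop :=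
  ∀ k E, h <+: k → k ++ [E] ∈ Q → ν (E ⊓ G) ≤ δ

/-- The positions after `h` and the subtrees of `Q` in which the moves are almost disjoint from a
set that is large in the atoms of `ℬₘ` containing the points of `V` have rank at most `ω ^ ξ`. -/
def SettlingBound (ν : ClopenAlg → ℝ≥0∞) (m : ℕ) (V : Set T) (δ : ℝ≥0∞)
    (Q : Set (List ClopenAlg)) (h : List ClopenAlg) (ξ : Ordinal.{0}) : Prop :=
  ∀ n, m < n → ∀ G, InLevel n G → (∀ u ∈ V, 1 < ν (copyPreimage m u G)) →
    ∀ Q' ⊆ Q, IsTree Q' → ∀ k, h <+: k → Settles ν δ G Q' k → RankBound Q' k (ω ^ ξ)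

/-- The positions in `Q` for which there is a covering sequence above `m` of the copy, in the
atom of `u`, of the union of the moves, that agrees with `c` up to `r₀`. -/
def coverTree (ν : ClopenAlg → ℝ≥0∞) (m : ℕ) (u : T) (Q : Set (List ClopenAlg))
    (r₀ : ℕ) (c : ℕ → ClopenAlg) : Set (List ClopenAlg) :=
  {h | h ∈ Q ∧ ∃ C, IsFullCovering ν m (copyPreimage m u (historyUnion h)) C ∧
    ∀ r ∈ Finset.Ioc m r₀, C r = c r}

/-- The positions in `coverTree` for which the covering sequence can be chosen with a small tail. -/
def smallTailTree (ν : ClopenAlg → ℝ≥0∞) (m : ℕ) (u : T) (Q : Set (List ClopenAlg))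
    (r₀ : ℕ) (c : ℕ → ClopenAlg) (δ : ℝ≥0∞) : Set (List ClopenAlg) :=
  {h | h ∈ Q ∧ ∃ C, IsFullCovering ν m (copyPreimage m u (historyUnion h)) C ∧
    (∀ r ∈ Finset.Ioc m r₀, C r = c r) ∧ ∀ R, ∑ r ∈ Finset.Ioc r₀ R, ν (C r) ≤ δ}

variable {ν : ClopenAlg → ℝ≥0∞} {m : ℕ} {u : T} {Q : Set (List ClopenAlg)}

theorem copyPreimage_historyUnion_mono {h k : List ClopenAlg} (hk : h <+: k) :
    copyPreimage m u (historyUnion h) ≤ copyPreimage m u (historyUnion k) :=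
  copyPreimage_mono m u (historyUnion_mono hk)

theorem isTree_coverTree (hQ : IsTree Q) (r₀ : ℕ) (c : ℕ → ClopenAlg) :
    IsTree (coverTree ν m u Q r₀ c) := by
  rintro h a ⟨h1, C, hC, h2⟩
  exact ⟨hQ _ _ h1, C, hC.anti (copyPreimage_historyUnion_mono (List.prefix_append h [a])), h2⟩

theorem isTree_smallTailTree (hQ : IsTree Q) (r₀ : ℕ) (c : ℕ → ClopenAlg) (δ : ℝ≥0∞) :
    IsTree (smallTailTree ν m u Q r₀ c δ) := by
  rintro h a ⟨h1, C, hC, h2⟩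
  exact ⟨hQ _ _ h1, C, hC.anti (copyPreimage_historyUnion_mono (List.prefix_append h [a])), h2⟩

/-- The complement of the common head, inside the atom, settles the tree: a move can meet it only in
the tail of a covering sequence, which has weight at most `δ`. -/
theorem rankBound_smallTailTree (hν : IsSubmeasure ν) (hT : 8 ≤ ν ⊤) (hQ : IsTree Q)
    {δ : ℝ≥0∞} {ξ : Ordinal.{0}} {h k : List ClopenAlg}
    (H : SettlingBound ν m {u} δ Q h ξ) (hk : h <+: k) {r₀ : ℕ} {c : ℕ → ClopenAlg} :
    RankBound (smallTailTree ν m u Q r₀ c δ) k (ω ^ ξ) := by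
  by_cases hne : ∃ a, k ++ [a] ∈ smallTailTree ν m u Q r₀ c δ
  swap
  · exact rankBound_of_forall_notMem _ (not_exists.1 hne)
  -- The head `c` is arbitrary, but one position in the tree suffices to give it the properties of a
  -- covering sequence.
  obtain ⟨a, -, C, hC, hCc, -⟩ := hne
  set S := (Finset.Ioc m r₀).sup c
  have hSC : S = (Finset.Ioc m r₀).sup C := Finset.sup_congr rfl fun r hr => (hCc r hr).symm
  have hlev : InLevel r₀ S := by
    rw [hSC]
    exact InLevel.finset_sup fun r hr =>
      (hC.inLevel r (Finset.mem_Ioc.1 hr).1).mono (Finset.mem_Ioc.1 hr).2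
  have hind : IndepBelow m S := by
    rw [hSC]
    exact IndepBelow.finset_sup fun r hr => hC.indep r (Finset.mem_Ioc.1 hr).1
  have hS : ν S ≤ 4 := by
    rw [hSC]
    exact (hν.finset_sup_le _ _).trans (hC.sum_le r₀)
  refine H (max r₀ (m + 1)) (by omega) (Sᶜ ⊓ atom m u) ?_ ?_ _ (fun _ h => h.1)
    (isTree_smallTailTree hQ r₀ c δ) k hk ?_
  · exact (hlev.compl.mono (le_max_left _ _)).inf ((inLevel_atom m u).mono (by omega))
  · rintro _ rfl
    rw [copyPreimage_inf_atom, copyPreimage_eq_self hind.compl]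
    by_contra hle
    have h8 : (8 : ℝ≥0∞) ≤ 4 + 1 := by
      calc (8 : ℝ≥0∞) ≤ ν (S ⊔ Sᶜ) := by rwa [sup_compl_eq_top]
        _ ≤ ν S + ν Sᶜ := hν.sup_le _ _
        _ ≤ 4 + 1 := add_le_add hS (not_lt.1 hle)
    exact absurd h8 (by norm_num)
  · rintro l E - ⟨-, D, hD, hDc, htail⟩
    set P := copyPreimage m u (historyUnion (l ++ [E]))
    set R := max (level P) (m + 1)
    refine (hν.mono _ ((Finset.Ioc r₀ R).sup D) ?_).trans
      ((hν.finset_sup_le _ _).trans (htail R))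
    rintro x ⟨hxE, hxS, hxu⟩
    have hxP : x ∈ P := by
      rw [mem_copyPreimage, copyMap_eq_self hxu]
      exact mem_historyUnion.2 ⟨E, by simp, hxE⟩
    obtain ⟨r, hr, hxr⟩ := hD.cover R (by omega) x
      (mem_interiorAt ((inLevel_level P).mono (le_max_left _ _)) hxP)
    rw [Finset.mem_Ioc] at hr
    refine mem_finset_sup.2 ⟨r, Finset.mem_Ioc.2 ⟨?_, hr.2⟩, hxr⟩
    by_contra hle
    have hr' : r ∈ Finset.Ioc m r₀ := Finset.mem_Ioc.2 ⟨hr.1, not_lt.1 hle⟩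
    exact hxS (mem_finset_sup.2 ⟨r, hr', by rwa [← hDc r hr']⟩)

/-- Here `j` more increments of `δ` would push the weight of the head beyond the permitted 4. Each
increment costs 2 in the exponent: one for the exit from `smallTailTree`, one for the finite union
over longer heads. -/
theorem rankBound_coverTree (hν : IsSubmeasure ν) (hT : 8 ≤ ν ⊤) (hQ : IsTree Q)
    {δ : ℝ≥0∞} {ξ : Ordinal.{0}} {h : List ClopenAlg}
    (H : SettlingBound ν m {u} δ Q h ξ) (j : ℕ) :
    ∀ (r₀ : ℕ) (c : ℕ → ClopenAlg) (k : List ClopenAlg), m ≤ r₀ → h <+: k →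
      4 < ∑ r ∈ Finset.Ioc m r₀, ν (c r) + j * δ →
      RankBound (coverTree ν m u Q r₀ c) k (ω ^ (ξ + (2 * j : ℕ))) := by
  induction j with
  | zero =>
    intro r₀ c k _ _ hsum
    refine rankBound_of_forall_notMem _ ?_
    rintro a ⟨-, C, hC, hCc⟩
    have := hC.sum_le r₀
    rw [Finset.sum_congr rfl fun r hr => by rw [hCc r hr]] at this
    simp only [Nat.cast_zero, zero_mul, add_zero] at hsum
    exact absurd this (not_le.2 hsum)
  | succ j ih =>
    intro r₀ c k hm hk hsum
    have hlt : ∀ a b : ℕ, a < b → ξ + (a : Ordinal.{0}) < ξ + (b : Ordinal.{0}) := by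
      intro a b hab
      simpa using hab
    refine rankBound_of_exit_opow (ξ := ξ) (η := ξ + (2 * j + 1 : ℕ)) ?_ (hlt _ _ (by omega))
      (rankBound_smallTailTree hν hT hQ (r₀ := r₀) (c := c) H hk) ?_
    · simp
    intro l hkl hl hl'
    set P := copyPreimage m u (historyUnion l)
    set r₁ := max (level P) (max r₀ (m + 1))
    have hr₁ : r₀ ≤ r₁ ∧ m < r₁ ∧ level P ≤ r₁ := by omega
    let e : (Finset.Ioc m r₁ → {X : ClopenAlg // InLevel r₁ X}) → ℕ → ClopenAlg :=
      fun i r => if hr : r ∈ Finset.Ioc m r₁ then (i ⟨r, hr⟩).1 else ⊥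
    -- The weight condition empties the trees of those heads to which the induction hypothesis does
    -- not apply.
    let F : (Finset.Ioc m r₁ → {X : ClopenAlg // InLevel r₁ X}) → Set (List ClopenAlg) := fun i =>
      {p | p ∈ coverTree ν m u Q r₁ (e i) ∧ 4 < ∑ r ∈ Finset.Ioc m r₁, ν (e i r) + j * δ}
    have hF : RankBound (⋃ i, F i) l (ω ^ (ξ + (2 * j : ℕ) + 1)) := by
      refine RankBound.iUnion (fun i p a (hp : p ++ [a] ∈ F i) =>
        show p ∈ F i from ⟨isTree_coverTree hQ _ _ _ _ hp.1, hp.2⟩) fun i => ?_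
      by_cases hi : 4 < ∑ r ∈ Finset.Ioc m r₁, ν (e i r) + j * δ
      · exact (ih r₁ (e i) l hr₁.2.1.le (hk.trans hkl) hi).anti fun p _ hp => hp.1
      · exact rankBound_of_forall_notMem _ fun a ha => hi ha.2
    rw [Nat.cast_add, Nat.cast_one, ← add_assoc]
    refine hF.anti ?_
    rintro p hlp ⟨hpQ, C, hC, hCc⟩
    have hCP : IsFullCovering ν m P C := hC.anti (copyPreimage_historyUnion_mono hlp)
    -- Otherwise `C` truncated at `r₁` would be a small-tail covering for the earlier position `l`,
    -- which lies outside `smallTailTree`.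
    have htail : δ < ∑ r ∈ Finset.Ioc r₀ r₁, ν (C r) := by
      by_contra hle
      refine hl' ⟨hl.1, _, hCP.truncate hν hr₁.2.1 ((inLevel_level P).mono hr₁.2.2), ?_, ?_⟩
      · intro r hr
        rw [if_pos ((Finset.mem_Ioc.1 hr).2.trans hr₁.1)]
        exact hCc r hr
      · intro R
        refine le_trans ?_ (not_lt.1 hle)
        calc ∑ r ∈ Finset.Ioc r₀ R, ν (if r ≤ r₁ then C r else ⊥)
            = ∑ r ∈ (Finset.Ioc r₀ R).filter (· ≤ r₁), ν (C r) := by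
              rw [Finset.sum_filter]
              refine Finset.sum_congr rfl fun r _ => ?_
              split_ifs
              · rfl
              · exact hν.bot
          _ ≤ ∑ r ∈ Finset.Ioc r₀ r₁, ν (C r) := by
              refine Finset.sum_le_sum_of_subset fun r hr => ?_
              simp only [Finset.mem_filter, Finset.mem_Ioc] at hr ⊢
              exact ⟨hr.1.1, hr.2⟩
    let i : Finset.Ioc m r₁ → {X : ClopenAlg // InLevel r₁ X} := fun r =>
      ⟨C r, (hC.inLevel r (Finset.mem_Ioc.1 r.2).1).mono (Finset.mem_Ioc.1 r.2).2⟩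
    have hei : ∀ r ∈ Finset.Ioc m r₁, C r = e i r := fun r hr => by simp only [e, i, dif_pos hr]
    refine Set.mem_iUnion.2 ⟨i, ⟨hpQ, C, hC, hei⟩, ?_⟩
    rw [← Finset.sum_congr rfl fun r hr => congrArg ν (hei r hr)]
    refine hsum.trans_le ?_
    rw [Finset.sum_congr rfl fun r hr => by rw [← hCc r hr], Nat.cast_add, Nat.cast_one, add_mul,
      one_mul, add_comm (_ * δ), ← add_assoc]
    gcongr
    calc ∑ r ∈ Finset.Ioc m r₀, ν (C r) + δ
        ≤ ∑ r ∈ Finset.Ioc m r₀, ν (C r) + ∑ r ∈ Finset.Ioc r₀ r₁, ν (C r) := by gcongr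
      _ = ∑ r ∈ Finset.Ioc m r₁, ν (C r) := by
        rw [← Finset.sum_union (Finset.Ioc_disjoint_Ioc_of_le le_rfl),
          Finset.Ioc_union_Ioc_eq_Ioc hm hr₁.1]

/-- With `r₀ = m` no head is prescribed, so leaving `coverTree` means that no covering sequence
exists. The covering property then makes the copy of the union of the moves large, and disjointness
lets that union settle the rest. -/
theorem exists_rankBound_of_settlingBound_singleton (hν : IsSubmeasure ν) (hcov : HasCovering ν)
    (hT : 8 ≤ ν ⊤) (m : ℕ) (u : T) {δ : ℝ≥0∞} (hδ : δ ≠ 0) :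
    ∃ l : ℕ, ∀ (Q : Set (List ClopenAlg)) (h : List ClopenAlg) (ξ : Ordinal.{0}), IsTree Q →
      (∀ k E, k ++ [E] ∈ Q → ∀ D ∈ k, Disjoint D E) → SettlingBound ν m {u} δ Q h ξ →
      RankBound Q h (ω ^ (ξ + l)) := by
  obtain ⟨j, hj⟩ := ENNReal.exists_nat_mul_gt hδ (show (4 : ℝ≥0∞) ≠ ∞ by simp)
  refine ⟨2 * j + 1, fun Q h ξ hQ hdisj H => ?_⟩
  have hb := rankBound_coverTree hν hT hQ H j m (fun _ => ⊥) h le_rfl (List.prefix_refl h)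
    (by simpa using hj)
  have hlt : ∀ a b : ℕ, a < b → ξ + (a : Ordinal.{0}) < ξ + (b : Ordinal.{0}) := by
    intro a b hab
    simpa using hab
  refine rankBound_of_exit_opow (η := ξ) (hlt _ _ (Nat.lt_succ_self _))
    (by simp) hb fun k hk hkQ hkC => ?_
  have h2 : 2 ≤ ν (copyPreimage m u (historyUnion k)) := by
    by_contra hlt
    obtain ⟨C, hC⟩ := hcov.exists_isFullCovering hν hT (indepBelow_copyPreimage m u _)
      (not_le.1 hlt)
    exact hkC ⟨hkQ, C, hC, by simp⟩
  set G := historyUnion k ⊓ atom m u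
  refine H (max (level G) (m + 1)) (by omega) G ((inLevel_level G).mono (le_max_left _ _)) ?_ Q
    subset_rfl hQ k hk ?_
  · rintro _ rfl
    rw [copyPreimage_inf_atom]
    exact lt_of_lt_of_le (by norm_num) h2
  · intro l E hkl hl
    have : E ⊓ G = ⊥ := by
      refine SetLike.ext fun x => ⟨?_, fun hx => absurd hx (Set.notMem_empty x)⟩
      rintro ⟨hxE, hxk, -⟩
      obtain ⟨D, hD, hxD⟩ := mem_historyUnion.1 hxk
      have := (hdisj l E hl D (hkl.subset hD)).le_bot (show x ∈ D ⊓ E from ⟨hxD, hxE⟩)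
      exact this
    rw [this, hν.bot]
    exact zero_le

/-- Atoms are settled one after another: the bound for `u` is applied inside each subtree already
settled for `t`, the settling sets are joined, and the errors `δ` add up. -/
theorem exists_rankBound_of_settlingBound_finset (hν : IsSubmeasure ν) (hcov : HasCovering ν)
    (hT : 8 ≤ ν ⊤) (m : ℕ) (t : Finset T) {δ : ℝ≥0∞} (hδ : δ ≠ 0) :
    ∃ l : ℕ, ∀ (Q : Set (List ClopenAlg)) (h : List ClopenAlg) (ξ : Ordinal.{0}), IsTree Q →
      (∀ k E, k ++ [E] ∈ Q → ∀ D ∈ k, Disjoint D E) →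
      SettlingBound ν m (t : Set T) (t.card * δ) Q h ξ → RankBound Q h (ω ^ (ξ + l)) := by
  classical
  induction t using Finset.induction_on with
  | empty =>
    refine ⟨0, fun Q h ξ hQ _ H => ?_⟩
    rw [Nat.cast_zero, add_zero]
    refine H (m + 1) (Nat.lt_succ_self m) ⊥ (inLevel_bot _) (by simp) Q subset_rfl hQ h
      (List.prefix_refl h) fun k E _ _ => ?_
    rw [inf_bot_eq, hν.bot]
    exact zero_le
  | insert u t hu ih =>
    obtain ⟨l, hl⟩ := ih
    obtain ⟨l', hl'⟩ := exists_rankBound_of_settlingBound_singleton hν hcov hT m u hδ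
    refine ⟨l' + l, fun Q h ξ hQ hdisj H => ?_⟩
    rw [Nat.cast_add, ← add_assoc]
    refine hl Q h _ hQ hdisj fun n hn G hG hGt Q' hQ' hQt k hk hset => ?_
    refine hl' Q' k ξ hQt (fun p E hp => hdisj p E (hQ' hp)) ?_
    intro n' hn' G' hG' hGu Q'' hQ'' hQt' p hp hset'
    refine H (max n n') (by omega) (G ⊔ G')
      ((hG.mono (le_max_left _ _)).sup (hG'.mono (le_max_right _ _))) ?_ Q'' (hQ''.trans hQ') hQt' p
      (hk.trans hp) ?_
    · intro v hv
      rcases Finset.mem_insert.1 (Finset.mem_coe.1 hv) with rfl | hv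
      · exact (hGu v rfl).trans_le (hν.mono _ _ (copyPreimage_mono m v le_sup_right))
      · exact (hGt v hv).trans_le (hν.mono _ _ (copyPreimage_mono m v le_sup_left))
    · intro q E hq hqE
      rw [inf_sup_left, Finset.card_insert_of_notMem hu, Nat.cast_add, Nat.cast_one, add_mul,
        one_mul]
      exact (hν.sup_le _ _).trans
        (add_le_add (hset q E (hp.trans hq) (hQ'' hqE)) (hset' q E hq hqE))

theorem exists_rankBound_of_settlingBound (hν : IsSubmeasure ν) (hcov : HasCovering ν)
    (hT : 8 ≤ ν ⊤) (m : ℕ) {δ : ℝ≥0∞} (hδ : δ ≠ 0) :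
    ∃ l : ℕ, ∀ (Q : Set (List ClopenAlg)) (h : List ClopenAlg) (ξ : Ordinal.{0}), IsTree Q →
      (∀ k E, k ++ [E] ∈ Q → ∀ D ∈ k, Disjoint D E) →
      SettlingBound ν m Set.univ δ Q h ξ → RankBound Q h (ω ^ (ξ + l)) := by
  obtain ⟨t, ht⟩ := exists_atom_representatives m
  have hδt : δ / t.card ≠ 0 := ENNReal.div_ne_zero.2 ⟨hδ, by simp⟩
  obtain ⟨l, hl⟩ := exists_rankBound_of_settlingBound_finset hν hcov hT m t hδt
  refine ⟨l, fun Q h ξ hQ hdisj H => hl Q h ξ hQ hdisj ?_⟩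
  intro n hn G hG hGt Q' hQ' hQt k hk hset
  refine H n hn G hG (fun x _ => ?_) Q' hQ' hQt k hk fun p E hp hpE =>
    (hset p E hp hpE).trans ENNReal.mul_div_le
  obtain ⟨u, hu, hux⟩ := ht x
  rw [← copyPreimage_congr hux]
  exact hGt u hu

end Settling

/-! ### Building thinness witnesses along the family game -/

section Main

variable {ν : ClopenAlg → ℝ≥0∞} {nrm : Finset ℕ → ℕ} {N : ℤ} {M : ℕ} {ε : ℝ}
  {Q : Set (List ClopenAlg)}

/-- `G` contains, for all `a < b` in `I`, a set in `ℬ_b` that is large in every atom of `ℬ_a`. -/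
def WitnessesThinness (ν : ClopenAlg → ℝ≥0∞) (I : Finset ℕ) (G : ClopenAlg) : Prop :=
  ∀ a ∈ I, ∀ b ∈ I, a < b → ∃ K ≤ G, InLevel b K ∧ ∀ u, 1 < ν (copyPreimage a u K)

theorem WitnessesThinness.isThin {I : Finset ℕ} {G : ClopenAlg} (h : WitnessesThinness ν I G)
    (E : ClopenAlg) : IsThin ν I (E \ G) := by
  intro a ha b hb hab u
  obtain ⟨K, hKG, hK, hlarge⟩ := h a ha b hb hab
  refine ⟨K ⊓ atom a u, hK.inf ((inLevel_atom a u).mono hab.le), ?_, ?_⟩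
  · rintro x ⟨hxK, hxu⟩
    exact ⟨hxu, fun hx => hx.2 (hKG hxK)⟩
  · rw [copyPreimage_inf_atom]
    exact hlarge u

theorem WitnessesThinness.insert {I : Finset ℕ} {G K : ClopenAlg} {m n : ℕ}
    (h : WitnessesThinness ν I G) (hm : m ∈ I) (hI : ∀ a ∈ I, a ≤ m) (hmn : m < n)
    (hK : InLevel n K) (hlarge : ∀ u, 1 < ν (copyPreimage m u K)) :
    WitnessesThinness ν (insert n I) (G ⊔ K) := by
  intro a ha b hb hab
  rcases Finset.mem_insert.1 ha with rfl | haI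
  · rcases Finset.mem_insert.1 hb with rfl | hb
    · exact absurd hab (lt_irrefl _)
    · have := hI b hb
      omega
  rcases Finset.mem_insert.1 hb with rfl | hbI
  · rcases (hI a haI).eq_or_lt with rfl | ham
    · exact ⟨K, le_sup_right, hK, hlarge⟩
    · obtain ⟨K', hK'G, hK', hl⟩ := h a haI m hm ham
      -- For `a < m` the old witness for the pair `(a, m)` also serves the pair `(a, n)`.
      exact ⟨K', hK'G.trans le_sup_left, hK'.mono hmn.le, hl⟩
  · obtain ⟨K', hK'G, hK', hl⟩ := h a haI b hbI hab
    exact ⟨K', hK'G.trans le_sup_left, hK', hl⟩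

theorem notMem_of_witnessesThinness (hν : IsSubmeasure ν) (hthin : HasThinness nrm N M ν)
    (hQ : ∀ k E, k ++ [E] ∈ Q → ENNReal.ofReal ((2 : ℝ) ^ (-N) + ε) ≤ ν E)
    {I : Finset ℕ} (hI : nrm I = M) {G : ClopenAlg} (hG : WitnessesThinness ν I G) {η : ℝ}
    (hη : 0 ≤ η) (hηε : η < ε) {h : List ClopenAlg} (hset : Settles ν (ENNReal.ofReal η) G Q h)
    (E : ClopenAlg) : h ++ [E] ∉ Q := by
  intro hE
  have h2 : (0 : ℝ) ≤ 2 ^ (-N) := by positivity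
  have key : ENNReal.ofReal ((2 : ℝ) ^ (-N) + ε) ≤ ENNReal.ofReal ((2 : ℝ) ^ (-N) + η) := by
    calc ENNReal.ofReal ((2 : ℝ) ^ (-N) + ε) ≤ ν E := hQ h E hE
      _ = ν (E \ G ⊔ E ⊓ G) := by rw [sup_comm, sup_inf_sdiff]
      _ ≤ ν (E \ G) + ν (E ⊓ G) := hν.sup_le _ _
      _ ≤ ENNReal.ofReal ((2 : ℝ) ^ (-N)) + ENNReal.ofReal η :=
        add_le_add (hthin _ ⟨I, hI, hG.isThin E⟩) (hset h E (List.prefix_refl h) hE)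
      _ = _ := (ENNReal.ofReal_add h2 hη).symm
  rw [ENNReal.ofReal_le_ofReal_iff (by positivity)] at key
  linarith

theorem rankBound_of_familyGame (hν : IsSubmeasure ν) (hcov : HasCovering ν) (hT : 8 ≤ ν ⊤)
    (hnrm : IsAdmissibleNorm nrm) (hthin : HasThinness nrm N M ν) {ξ : Ordinal.{0}}
    {σ : List ℕ → Ordinal.{0}} (hσ : IsWinningStrategy (familyGame {F | nrm F < M}) ξ σ)
    (g : List ℕ) (m : ℕ) (hg : LegalRun (familyGame {F | nrm F < M}) (g ++ [m]))
    (hQ : IsTree Q)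
    (hleg : ∀ k E, k ++ [E] ∈ Q → exhaustivityGame ν (ENNReal.ofReal ((2 : ℝ) ^ (-N) + ε)) k E)
    (h : List ClopenAlg) (G : ClopenAlg) (hG : WitnessesThinness ν (g ++ [m]).toFinset G)
    (η : ℝ) (hη : 0 ≤ η) (hηε : η < ε) (hset : Settles ν (ENNReal.ofReal η) G Q h) :
    RankBound Q h (ω ^ (ω * (σ (g ++ [m]) + 1))) := by
  obtain ⟨o, ho⟩ : ∃ o, o = σ (g ++ [m]) := ⟨_, rfl⟩
  rw [← ho]
  induction o using WellFoundedLT.induction generalizing g m Q h G η with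
  | ind o ih =>
    have hfam := (legalRun_append_singleton.1 hg).2
    have hlast : ∀ a ∈ (g ++ [m]).toFinset, a ≤ m := by
      intro a ha
      rcases List.mem_append.1 (List.mem_toFinset.1 ha) with ha | ha
      · exact (hfam.1 a ha).le
      · exact (List.mem_singleton.1 ha).le
    -- Spending half of the remaining slack keeps the total error below `ε`, however many levels
    -- follow.
    have hδ : 0 < (ε - η) / 2 := by linarith
    obtain ⟨l, hl⟩ := exists_rankBound_of_settlingBound hν hcov hT m
      (δ := ENNReal.ofReal ((ε - η) / 2)) (ENNReal.ofReal_pos.2 hδ).ne'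
    -- The number `l` depends on `m` and the slack but is finite, so one step of the strategy, worth
    -- `ω` in the exponent, pays for it.
    have hωo : ω * o + l ≤ ω * (o + 1) := by
      rw [mul_add, mul_one]
      exact add_le_add_right (Ordinal.natCast_lt_omega0 l).le _
    refine (hl Q h (ω * o) hQ (fun k E hk => (hleg k E hk).1) ?_).mono
      (Ordinal.opow_le_opow_right Ordinal.omega0_pos hωo)
    intro n hmn K hK hlarge Q' hQ' hQt k hk hsetK
    have hins : (g ++ [m] ++ [n]).toFinset = insert n (g ++ [m]).toFinset := by
      ext; simp; tauto
    have hG' : WitnessesThinness ν (insert n (g ++ [m]).toFinset) (G ⊔ K) :=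
      hG.insert (by simp) hlast hmn hK fun u => hlarge u (Set.mem_univ u)
    have hset' : Settles ν (ENNReal.ofReal (η + (ε - η) / 2)) (G ⊔ K) Q' k := by
      intro p E hp hpE
      rw [inf_sup_left, ENNReal.ofReal_add hη hδ.le]
      exact (hν.sup_le _ _).trans (add_le_add (hset p E (hk.trans hp) (hQ' hpE)) (hsetK p E hp hpE))
    have hleg' := fun p E (hp : p ++ [E] ∈ Q') => hleg p E (hQ' hp)
    by_cases hn : nrm (insert n (g ++ [m]).toFinset) < M
    · have hg' : LegalRun (familyGame {F | nrm F < M}) (g ++ [m] ++ [n]) := by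
        refine legalRun_append_singleton.2 ⟨hg, fun b hb => ?_, ?_⟩
        · exact (hlast b (List.mem_toFinset.2 hb)).trans_lt hmn
        · rw [hins]
          exact hn
      have hlt : σ (g ++ [m] ++ [n]) < o := ho ▸ hσ.next_lt _ _ hg'
      refine (ih _ hlt (g ++ [m]) n hg' hQt hleg' k (G ⊔ K) (hins ▸ hG') (η + (ε - η) / 2)
        (by linarith) (by linarith) hset' rfl).mono ?_
      refine Ordinal.opow_le_opow_right Ordinal.omega0_pos (mul_le_mul_right ?_ _)
      exact Order.add_one_le_of_lt hlt
    -- One new point raises the norm by at most 1, so on leaving the family the norm is exactly `M`,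
    -- as thinness requires.
    · have hM : nrm (insert n (g ++ [m]).toFinset) = M := by
        have h1 := hnrm.union_le {n} (g ++ [m]).toFinset
        rw [hnrm.singleton, ← Finset.insert_eq] at h1
        have h2 : nrm (g ++ [m]).toFinset < M := hfam.2
        omega
      exact rankBound_of_forall_notMem _ (notMem_of_witnessesThinness hν hthin
        (fun p E hp => (hleg' p E hp).2) hM hG' (by linarith) (by linarith) hset')

end Main

end ExhaustivityRank

theorem mainTheorem7
    (ν : ExhaustivityRank.ClopenAlg → ℝ≥0∞)
    (hν : ExhaustivityRank.IsSubmeasure ν)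
    (hcov : ExhaustivityRank.HasCovering ν)
    (hT : 8 ≤ ν ⊤)
    (nrm : Finset ℕ → ℕ)
    (hnrm : ExhaustivityRank.IsAdmissibleNorm nrm)
    (N : ℤ) (M : ℕ)
    (hthin : ExhaustivityRank.HasThinness nrm N M ν)
    (ε : ℝ) (hε : 0 < ε) :
    ExhaustivityRank.PlayerIWins
        (ExhaustivityRank.exhaustivityGame ν (ENNReal.ofReal ((2 : ℝ) ^ (-N) + ε)))
        (ω ^ (ω * (ExhaustivityRank.rho {F : Finset ℕ | nrm F < M} + 1))) ∧
      ∃ hwf : WellFounded (ExhaustivityRank.DisjointFamily.Extends (ν := ν)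
          (c := ENNReal.ofReal ((2 : ℝ) ^ (-N) + ε))),
        ExhaustivityRank.exhaustivityRank ν (ENNReal.ofReal ((2 : ℝ) ^ (-N) + ε)) hwf ≤
          ω ^ (ω * (ExhaustivityRank.rho {F : Finset ℕ | nrm F < M} + 1)) := by
  open ExhaustivityRank in
  suffices H : PlayerIWins (exhaustivityGame ν (ENNReal.ofReal ((2 : ℝ) ^ (-N) + ε)))
      (ω ^ (ω * (rho {F : Finset ℕ | nrm F < M} + 1))) from ⟨H, H.exhaustivityRank_le⟩
  open ExhaustivityRank in
  refine RankBound.playerIWins ?_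
  have hset : ∀ Q, Settles ν (ENNReal.ofReal 0) ⊥ Q [] := fun Q k E _ _ => by
    rw [inf_bot_eq, hν.bot]
    exact zero_le
  have hleg : ∀ k E, k ++ [E] ∈ {h | LegalRun (exhaustivityGame ν
      (ENNReal.ofReal ((2 : ℝ) ^ (-N) + ε))) h} → exhaustivityGame ν
      (ENNReal.ofReal ((2 : ℝ) ^ (-N) + ε)) k E :=
    fun k E hk => (legalRun_append_singleton.1 hk).2
  -- If `M ≤ 1`, a set without pairs already has norm `M`; thinness is vacuous and Player II has no
  -- first move. Otherwise 0 is a legal first move in the family game and `⊥` witnesses thinness for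
  -- `{0}`.
  by_cases hM : ∃ I : Finset ℕ, I ⊆ {0} ∧ nrm I = M
  · obtain ⟨I, hI, hIM⟩ := hM
    have hw : WitnessesThinness ν I ⊥ := fun a ha b hb hab => by
      have h1 := Finset.mem_singleton.1 (hI ha)
      have h2 := Finset.mem_singleton.1 (hI hb)
      omega
    exact rankBound_of_forall_notMem _ (notMem_of_witnessesThinness hν hthin
      (fun k E hk => (hleg k E hk).2) hIM hw le_rfl hε (hset _))
  · push Not at hM
    have h0 := hM ∅ (by simp)
    have h1 := hM {0} subset_rfl
    rw [hnrm.empty] at h0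
    rw [hnrm.singleton] at h1
    obtain ⟨σ, hσ⟩ := rho_spec hnrm M
    have hrun : LegalRun (familyGame {F | nrm F < M}) ([] ++ [0]) := by
      refine legalRun_append_singleton.2 ⟨fun h a hk => by simp at hk, by simp, ?_⟩
      show nrm {0} < M
      rw [hnrm.singleton]
      omega
    have hw : WitnessesThinness ν ([] ++ [0]).toFinset ⊥ := fun a ha b hb hab => by
      simp at ha hb
      omega
    refine (rankBound_of_familyGame hν hcov hT hnrm hthin hσ [] 0 hrun (LegalRun.isTree _) hleg []
      ⊥ hw 0 le_rfl hε (hset _)).mono ?_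
    refine Ordinal.opow_le_opow_right Ordinal.omega0_pos (mul_le_mul_right ?_ _)
    exact add_le_add_left ((hσ.next_lt _ _ hrun).le.trans hσ.first_le) 1
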